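/- Let $0<q<1$ and, for $n\in\mathbb Z$, put $$\alpha=\frac{q^{1/2}+q^{-1/2}}2,\qquad \alpha_n=\frac{q^{n/2}+q^{-n/2}}2,\qquad \gamma_n=\frac{q^{n/2}-q^{-n/2}}{q^{1/2}-q^{-1/2}} .$$ Let $\mathcal D_q$ be the Askey–Wilson operator on polynomials with complex coefficients, $$(\mathcal D_q f)\Big(\frac{z+z^{-1}}2\Big)=\frac{\breve f(q^{1/2}z)-\breve f(q^{-1/2}z)}{\breve e(q^{1/2}z)-\breve e(q^{-1/2}z)},\qquad \breve f(z)=f\Big(\frac{z+z^{-1}}2\Big),\quad e(x)=x .$$ A sequence of polynomials $(P_n)_{n\ge0}$ with $\deg P_n=n$ is an orthogonal polynomial sequence (OPS) if there is a linear functional $\mathbf u$ on the complex polynomials such that $\langle\mathbf u,P_nP_m\rangle=\kappa_n\delta_{n,m}$ with $\kappa_n\in\mathbb C\setminus\{0\}$. A monic OPS $(P_n)_{n\ge0}$ is called classical (on the $q$-quadratic lattice) if $(\mathcal D_qP_{n+1})_{n\ge0}$ is an OPS. Theorem 2. Let $B_0,B_1,C_1,C_2$ be complex numbers with $C_2\neq0$.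 Define $$a=\frac{\alpha(3-4\alpha^2)}{4\alpha^2-1}+\frac{(B_0+B_1)^2+4\alpha^2(C_1-B_0B_1+\alpha^2-1)}{2\alpha(4\alpha^2-1)C_2},\qquad b=(a+\alpha)B_1-\frac{B_0+B_1}{2\alpha},$$ $$d_n=a\gamma_n+\alpha_n,\qquad e_n=(b+aB_0)\gamma_n+B_0\alpha_n,$$ $$\phi^{[n]}(z)=\big((\alpha^2-1)\gamma_{2n}+a\alpha_{2n}\big)\big(z^2-\tfrac12\big)-\big((b+aB_0)\alpha_n+(\alpha^2-1)B_0\gamma_n\big)z+bB_0-(a+\alpha)C_1+\tfrac a2 .$$ Assume that $d_n\neq0$ for all $n\ge0$, and consider the sequences given for $n=0,1,2,\dots$ by $$B_n=\frac{\gamma_{n+1}e_n}{d_{2n}}-\frac{\gamma_ne_{n-1}}{d_{2n-2}},\qquad C_{n+1}=-\frac{\gamma_{n+1}d_{n-1}}{d_{2n-1}d_{2n+1}}\,\phi^{[n]}\Big(\frac{e_n}{d_{2n}}\Big),$$ where for $n=0$ the term with the factor $\gamma_0=0$ is read as $0$ and the quotient $d_{-1}/d_{-1}$ is read as $1$. (For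 $n=0,1$ these formulas return the given numbers $B_0,B_1,C_1,C_2$.) Assume that $C_n\neq0$ for all $n\ge1$. If $(P_n)_{n\ge0}$ is a monic OPS satisfying $$xP_n(x)=P_{n+1}(x)+B_nP_n(x)+C_nP_{n-1}(x),\qquad n=0,1,2,\dots,\quad P_{-1}=0,$$ with these coefficients, then $(P_n)_{n\ge0}$ is classical, i.e. $(\mathcal D_qP_{n+1})_{n\ge0}$ is an OPS. -/

import Mathlib

open Polynomial

noncomputable section

namespace QLattice

/-- The number `q^{1/2}`, as a complex number. -/
def sqrtQ (q : ℝ) : ℂ := ((Real.sqrt q : ℝ) : ℂ)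

/-- `α_n = (q^{n/2} + q^{-n/2}) / 2`. -/
def alphaN (q : ℝ) (n : ℤ) : ℂ := (sqrtQ q ^ n + sqrtQ q ^ (-n)) / 2

/-- `γ_n = (q^{n/2} - q^{-n/2}) / (q^{1/2} - q^{-1/2})`. -/
def gammaN (q : ℝ) (n : ℤ) : ℂ :=
  (sqrtQ q ^ n - sqrtQ q ^ (-n)) / (sqrtQ q - (sqrtQ q)⁻¹)

/-- `α = (q^{1/2} + q^{-1/2}) / 2`. -/
def alpha (q : ℝ) : ℂ := (sqrtQ q + (sqrtQ q)⁻¹) / 2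

/-! ### The Askey-Wilson operator -/

/-- `f˘(z) = f((z + 1/z)/2)`. -/
def breve (f : ℂ[X]) (z : ℂ) : ℂ := f.eval ((z + z⁻¹) / 2)

/-- `g` is the image of `f` under the Askey-Wilson divided difference operator:
`g((z + 1/z)/2)` equals the quotient defining the operator, at all `z` where the quotient makes
sense (its denominator is `(q^{1/2} - q^{-1/2})(z - 1/z)/2`). -/
def IsAskeyWilsonImage (q : ℝ) (f g : ℂ[X]) : Prop :=
  ∀ z : ℂ, z ≠ 0 → z ^ 2 ≠ 1 →
    breve g z =
      (breve f (sqrtQ q * z) - breve f ((sqrtQ q)⁻¹ * z)) /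
        (breve X (sqrtQ q * z) - breve X ((sqrtQ q)⁻¹ * z))

theorem sqrtQ_ne_zero {q : ℝ} (h0 : 0 < q) : sqrtQ q ≠ 0 := by
  unfold sqrtQ
  exact_mod_cast (Real.sqrt_pos.2 h0).ne'

theorem sqrtQ_sq {q : ℝ} (h0 : 0 < q) : sqrtQ q ^ 2 = (q : ℂ) := by
  unfold sqrtQ
  exact_mod_cast congrArg (fun t : ℝ => (t : ℂ)) (Real.sq_sqrt h0.le)

theorem breve_X_sub {q : ℝ} (h0 : 0 < q) {z : ℂ} (hz : z ≠ 0) :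
    breve X (sqrtQ q * z) - breve X ((sqrtQ q)⁻¹ * z) =
      (sqrtQ q - (sqrtQ q)⁻¹) * (z - z⁻¹) / 2 := by
  have hp := sqrtQ_ne_zero h0
  simp only [breve, eval_X]
  field_simp
  ring

theorem breve_X_sub_ne_zero {q : ℝ} (h0 : 0 < q) (h1 : q < 1) {z : ℂ} (hz : z ≠ 0)
    (hz2 : z ^ 2 ≠ 1) :
    breve X (sqrtQ q * z) - breve X ((sqrtQ q)⁻¹ * z) ≠ 0 := by
  have hp := sqrtQ_ne_zero h0
  rw [breve_X_sub h0 hz]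
  have e1 : sqrtQ q - (sqrtQ q)⁻¹ ≠ 0 := by
    intro h
    have h2 : sqrtQ q ^ 2 = 1 := by
      field_simp at h
      linear_combination h
    rw [sqrtQ_sq h0] at h2
    exact h1.ne (by exact_mod_cast h2)
  have e2 : z - z⁻¹ ≠ 0 := by
    intro h
    apply hz2
    field_simp at h
    linear_combination h
  exact div_ne_zero (mul_ne_zero e1 e2) two_ne_zero

theorem exists_divided_difference {q : ℝ} (h0 : 0 < q) (f : ℂ[X]) :
    ∃ g s : ℂ[X], ∀ z : ℂ, z ≠ 0 →
      breve g z * (breve X (sqrtQ q * z) - breve X ((sqrtQ q)⁻¹ * z)) =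
          breve f (sqrtQ q * z) - breve f ((sqrtQ q)⁻¹ * z) ∧
        2 * breve s z = breve f (sqrtQ q * z) + breve f ((sqrtQ q)⁻¹ * z) := by
  have hp := sqrtQ_ne_zero h0
  induction f using Polynomial.induction_on with
  | C a => exact ⟨0, C a, fun z _ => by simp [breve, two_mul]⟩
  | add f₁ f₂ ih₁ ih₂ =>
    obtain ⟨g₁, s₁, H₁⟩ := ih₁
    obtain ⟨g₂, s₂, H₂⟩ := ih₂
    refine ⟨g₁ + g₂, s₁ + s₂, fun z hz => ?_⟩
    obtain ⟨a₁, b₁⟩ := H₁ z hz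
    obtain ⟨a₂, b₂⟩ := H₂ z hz
    simp only [breve, eval_add] at *
    constructor
    · linear_combination a₁ + a₂
    · linear_combination b₁ + b₂
  | monomial n a ih =>
    obtain ⟨g, s, H⟩ := ih
    refine ⟨s + C (alpha q) * X * g,
      C (alpha q ^ 2 - 1) * (X ^ 2 - 1) * g + C (alpha q) * X * s, fun z hz => ?_⟩
    obtain ⟨h, k⟩ := H z hz
    rw [breve_X_sub h0 hz] at h ⊢
    rw [pow_succ, ← mul_assoc]
    generalize C a * X ^ n = f at h k ⊢
    simp only [breve, eval_add, eval_mul, eval_sub, eval_pow, eval_C, eval_X, eval_one,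
      alpha] at *
    generalize eval ((sqrtQ q * z + (sqrtQ q * z)⁻¹) / 2) f = F at *
    generalize eval (((sqrtQ q)⁻¹ * z + ((sqrtQ q)⁻¹ * z)⁻¹) / 2) f = G at *
    generalize eval ((z + z⁻¹) / 2) g = u at *
    generalize eval ((z + z⁻¹) / 2) s = v at *
    generalize sqrtQ q = p at *
    simp only [mul_inv, inv_inv]
    have hp' : p * p⁻¹ = 1 := mul_inv_cancel₀ hp
    have hz' : z * z⁻¹ = 1 := mul_inv_cancel₀ hz
    generalize p⁻¹ = r at *
    generalize z⁻¹ = w at *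
    have hF : F = v + u * ((p - r) * (z - w) / 2) / 2 := by linear_combination (-h - k) / 2
    have hG : G = v - u * ((p - r) * (z - w) / 2) / 2 := by linear_combination (h - k) / 2
    subst hF hG
    constructor
    · ring
    · have e1 : ((p + r) / 2) ^ 2 - 1 = ((p - r) / 2) ^ 2 := by linear_combination hp'
      have e2 : ((z + w) / 2) ^ 2 - 1 = ((z - w) / 2) ^ 2 := by linear_combination hz'
      rw [e1, e2]
      ring

/-- For `0 < q < 1` the Askey-Wilson operator is well defined on polynomials. -/
theorem existsUnique_askeyWilsonImage {q : ℝ} (h0 : 0 < q) (h1 : q < 1) (f : ℂ[X]) :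
    ∃! g : ℂ[X], IsAskeyWilsonImage q f g := by
  obtain ⟨g, s, H⟩ := exists_divided_difference h0 f
  have hg : IsAskeyWilsonImage q f g := fun z hz hz2 => by
    rw [eq_div_iff (breve_X_sub_ne_zero h0 h1 hz hz2)]
    exact (H z hz).1
  refine ⟨g, hg, fun g' hg' => ?_⟩
  apply Polynomial.eq_of_infinite_eval_eq
  refine Set.infinite_of_injective_forall_mem
    (f := fun n : ℕ => (((n : ℂ) + 2) + ((n : ℂ) + 2)⁻¹) / 2) ?_ ?_
  · intro m n hmn
    have hm : (m : ℂ) + 2 ≠ 0 := by exact_mod_cast (Nat.succ_ne_zero (m + 1))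
    have hn : (n : ℂ) + 2 ≠ 0 := by exact_mod_cast (Nat.succ_ne_zero (n + 1))
    simp only at hmn
    have key : ((m : ℂ) - n) * (((m : ℂ) + 2) * ((n : ℂ) + 2) - 1) = 0 := by
      field_simp at hmn
      linear_combination hmn
    rcases mul_eq_zero.1 key with h | h
    · exact_mod_cast sub_eq_zero.1 h
    · exfalso
      have h' : (m + 2) * (n + 2) = 1 := by exact_mod_cast sub_eq_zero.1 h
      nlinarith
  · intro n
    have hn : (n : ℂ) + 2 ≠ 0 := by exact_mod_cast (Nat.succ_ne_zero (n + 1))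
    have hn2 : ((n : ℂ) + 2) ^ 2 ≠ 1 := by
      intro h
      have h' : (n + 2) ^ 2 = 1 := by exact_mod_cast h
      have h2 : 2 ^ 2 ≤ (n + 2) ^ 2 := Nat.pow_le_pow_left (Nat.le_add_left 2 n) 2
      omega
    exact (hg' _ hn hn2).trans (hg _ hn hn2).symm

/-- The Askey-Wilson operator `D_q` on polynomials (meaningful for `0 < q < 1`). -/
def askeyWilson (q : ℝ) (f : ℂ[X]) : ℂ[X] :=
  Classical.epsilon (IsAskeyWilsonImage q f)

theorem askeyWilson_spec {q : ℝ} (h0 : 0 < q) (h1 : q < 1) (f : ℂ[X]) :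
    IsAskeyWilsonImage q f (askeyWilson q f) :=
  Classical.epsilon_spec (existsUnique_askeyWilsonImage h0 h1 f).exists

/-! ### Orthogonal polynomial sequences -/

/-- `P` is an orthogonal polynomial sequence with respect to the linear functional `u`:
`deg P_n = n` and `⟨u, P_n P_m⟩ = κ_n δ_{n,m}` with `κ_n ≠ 0`. -/
def IsOPS (u : ℂ[X] →ₗ[ℂ] ℂ) (P : ℕ → ℂ[X]) : Prop :=
  (∀ n, (P n).degree = n) ∧
    (∀ n m, n ≠ m → u (P n * P m) = 0) ∧ ∀ n, u (P n * P n) ≠ 0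

/-- Monic orthogonal polynomial sequences. -/
def IsMonicOPS (u : ℂ[X] →ₗ[ℂ] ℂ) (P : ℕ → ℂ[X]) : Prop :=
  IsOPS u P ∧ ∀ n, (P n).Monic

/-- The three term recurrence relation `x P_n = P_{n+1} + B_n P_n + C_n P_{n-1}` with `P_{-1} = 0`.
The value `Csucc n` is `C_{n+1}`. -/
def HasTTRR (P : ℕ → ℂ[X]) (B Csucc : ℕ → ℂ) : Prop :=
  X * P 0 = P 1 + C (B 0) * P 0 ∧
    ∀ n, X * P (n + 1) = P (n + 2) + C (B (n + 1)) * P (n + 1) + C (Csucc n) * P n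

/-- A monic OPS `P` with respect to `u` is classical if `(D_q P_{n+1})_{n ≥ 0}` is orthogonal, i.e.
is an OPS with respect to some linear functional. -/
def IsClassical (q : ℝ) (u : ℂ[X] →ₗ[ℂ] ℂ) (P : ℕ → ℂ[X]) : Prop :=
  IsMonicOPS u P ∧ ∃ v : ℂ[X] →ₗ[ℂ] ℂ, IsOPS v (fun n => askeyWilson q (P (n + 1)))

/-! ### The explicit coefficients -/

/-- The number `a` determined by `B_0, B_1, C_1, C_2`. -/
def parA (q : ℝ) (B₀ B₁ C₁ C₂ : ℂ) : ℂ :=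
  alpha q * (3 - 4 * alpha q ^ 2) / (4 * alpha q ^ 2 - 1) +
    ((B₀ + B₁) ^ 2 + 4 * alpha q ^ 2 * (C₁ - B₀ * B₁ + alpha q ^ 2 - 1)) /
      (2 * alpha q * (4 * alpha q ^ 2 - 1) * C₂)

/-- The number `b` determined by `a, B_0, B_1`. -/
def parB (q : ℝ) (a B₀ B₁ : ℂ) : ℂ :=
  (a + alpha q) * B₁ - (B₀ + B₁) / (2 * alpha q)

/-- `d_n = a γ_n + α_n`. -/
def dSeq (q : ℝ) (a : ℂ) (n : ℤ) : ℂ := a * gammaN q n + alphaN q n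

/-- `e_n = (b + a B_0) γ_n + B_0 α_n`. -/
def eSeq (q : ℝ) (a b B₀ : ℂ) (n : ℤ) : ℂ := (b + a * B₀) * gammaN q n + B₀ * alphaN q n

/-- The polynomial function `φ^{[n]}`. -/
def phiN (q : ℝ) (a b B₀ C₁ : ℂ) (n : ℤ) (z : ℂ) : ℂ :=
  ((alpha q ^ 2 - 1) * gammaN q (2 * n) + a * alphaN q (2 * n)) * (z ^ 2 - 1 / 2) -
      ((b + a * B₀) * alphaN q n + (alpha q ^ 2 - 1) * B₀ * gammaN q n) * z +
    b * B₀ - (a + alpha q) * C₁ + a / 2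

/-- `B_n = γ_{n+1} e_n / d_{2n} - γ_n e_{n-1} / d_{2n-2}`. For `n = 0` the second term is `0`
because of the factor `γ_0 = 0`. -/
def recB (q : ℝ) (a b B₀ : ℂ) (n : ℕ) : ℂ :=
  gammaN q (n + 1) * eSeq q a b B₀ n / dSeq q a (2 * n) -
    gammaN q n * eSeq q a b B₀ (n - 1) / dSeq q a (2 * n - 2)

/-- The quotient `d_{n-1} / d_{2n-1}`, which for `n = 0` is `d_{-1} / d_{-1}`, read as `1`. -/
def dRatio (q : ℝ) (a : ℂ) (n : ℕ) : ℂ :=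
  if n = 0 then 1 else dSeq q a (n - 1) / dSeq q a (2 * n - 1)

/-- The value at `n` is `C_{n+1}`, where
`C_{n+1} = - γ_{n+1} d_{n-1} / (d_{2n-1} d_{2n+1}) φ^{[n]}(e_n / d_{2n})`. -/
def recC (q : ℝ) (a b B₀ C₁ : ℂ) (n : ℕ) : ℂ :=
  -(gammaN q (n + 1) / dSeq q a (2 * n + 1) * dRatio q a n) *
    phiN q a b B₀ C₁ n (eSeq q a b B₀ n / dSeq q a (2 * n))

end QLattice

end

open Polynomial

/-! Put g_n = D_q P_n, so g_0 = 0 and g_1 = 1. By Favard's theorem (`exists_isOPS_of_recurrence`) it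
suffices that x g_{n+1} = A_n g_{n+2} + B'_n g_{n+1} + C'_n g_n with A_n ≠ 0 for n ≥ 0 and C'_n ≠ 0
for n ≥ 1. The explicit solution is A_n = γ_{n+1}/γ_{n+2}, B'_n = γ_{n+1} x_{n+1} - γ_n x_n with x_n
= e_n/d_{2n}, and C'_n = (d_n/d_{n-1}) C_{n+1}.

The recurrence is proved by induction. D_q satisfies a second-order commutation relation with x
(`askeyWilson_X_mul_X_mul`); applied to P_m, with x²P_m expanded by the recurrence of P, it links
five consecutive g's. Two earlier instances of the claimed recurrence turn this into the next one
(`recurrence_step`), provided five scalar identities hold, one for each g. These follow from the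
linear recurrences of γ, d and e, the addition formula `dSeq_mul_gammaN_sub` and, for the g_m
coefficient, the difference formula `phiN_sub_phiN`. -/

namespace QLattice

/-! ### Identities for γ, α, d, e and φ -/

section Constants

theorem sqrtQ_pow_ne_one {q : ℝ} (h1 : q < 1) {n : ℕ} (hn : n ≠ 0) :
    sqrtQ q ^ n ≠ 1 := by
  unfold sqrtQ
  have h : Real.sqrt q ^ n < 1 :=
    pow_lt_one₀ (Real.sqrt_nonneg q) ((Real.sqrt_lt' one_pos).2 (by simpa using h1)) hn
  exact_mod_cast h.ne

theorem sqrtQ_sub_inv_ne_zero {q : ℝ} (h0 : 0 < q) (h1 : q < 1) :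
    sqrtQ q - (sqrtQ q)⁻¹ ≠ 0 := by
  have hp := sqrtQ_ne_zero h0
  intro h
  apply sqrtQ_pow_ne_one h1 two_ne_zero
  field_simp at h
  linear_combination h

theorem gammaN_natCast_ne_zero {q : ℝ} (h0 : 0 < q) (h1 : q < 1) {n : ℕ} (hn : n ≠ 0) :
    gammaN q n ≠ 0 := by
  have hp := sqrtQ_ne_zero h0
  refine div_ne_zero (fun h => ?_) (sqrtQ_sub_inv_ne_zero h0 h1)
  apply sqrtQ_pow_ne_one h1 (n := 2 * n) (by omega)
  have hw : sqrtQ q ^ n ≠ 0 := pow_ne_zero _ hp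
  rw [zpow_neg, zpow_natCast] at h
  rw [two_mul, pow_add]
  field_simp at h
  linear_combination h

@[simp] theorem gammaN_zero (q : ℝ) : gammaN q 0 = 0 := by simp [gammaN]

theorem gammaN_one {q : ℝ} (h0 : 0 < q) (h1 : q < 1) : gammaN q 1 = 1 := by
  simp [gammaN, sqrtQ_sub_inv_ne_zero h0 h1]

theorem gammaN_add_two {q : ℝ} (h0 : 0 < q) (n : ℤ) :
    gammaN q (n + 2) = 2 * alpha q * gammaN q (n + 1) - gammaN q n := by
  have hp := sqrtQ_ne_zero h0
  have hw : sqrtQ q ^ n ≠ 0 := zpow_ne_zero _ hp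
  simp only [gammaN, alpha, zpow_neg, zpow_add₀ hp, zpow_ofNat, div_eq_mul_inv]
  generalize (sqrtQ q - (sqrtQ q)⁻¹)⁻¹ = t
  field_simp
  ring

theorem alphaN_add_two {q : ℝ} (h0 : 0 < q) (n : ℤ) :
    alphaN q (n + 2) = 2 * alpha q * alphaN q (n + 1) - alphaN q n := by
  have hp := sqrtQ_ne_zero h0
  have hw : sqrtQ q ^ n ≠ 0 := zpow_ne_zero _ hp
  simp only [alphaN, alpha, zpow_neg, zpow_add₀ hp, zpow_ofNat]
  field_simp
  ring

theorem dSeq_add_two {q : ℝ} (h0 : 0 < q) (a : ℂ) (n : ℤ) :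
    dSeq q a (n + 2) = 2 * alpha q * dSeq q a (n + 1) - dSeq q a n := by
  simp only [dSeq, gammaN_add_two h0, alphaN_add_two h0]
  ring

theorem eSeq_add_two {q : ℝ} (h0 : 0 < q) (a b B₀ : ℂ) (n : ℤ) :
    eSeq q a b B₀ (n + 2) = 2 * alpha q * eSeq q a b B₀ (n + 1) - eSeq q a b B₀ n := by
  simp only [eSeq, gammaN_add_two h0, alphaN_add_two h0]
  ring

/-- The conserved quantity of the recurrence satisfied by `γ`. -/
theorem gammaN_sq_sub {q : ℝ} (h0 : 0 < q) (h1 : q < 1) (n : ℤ) :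
    gammaN q (n + 1) ^ 2 - 2 * alpha q * gammaN q (n + 1) * gammaN q n + gammaN q n ^ 2 = 1 := by
  have hp := sqrtQ_ne_zero h0
  have hw : sqrtQ q ^ n ≠ 0 := zpow_ne_zero _ hp
  have ht := sqrtQ_sub_inv_ne_zero h0 h1
  simp only [gammaN, alpha, zpow_neg, zpow_add₀ hp, zpow_one]
  rw [← sub_eq_zero]
  have hp2 : sqrtQ q ^ 2 - 1 ≠ 0 := sub_ne_zero.2 (sqrtQ_pow_ne_one h1 two_ne_zero)
  field_simp
  ring

/-- Addition formula for `γ` and `d`. -/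
theorem dSeq_mul_gammaN_sub {q : ℝ} (h0 : 0 < q) (h1 : q < 1) (a : ℂ) (m k : ℤ) :
    dSeq q a (m + 1) * gammaN q (k + 1) - dSeq q a m * gammaN q k = dSeq q a (m + k + 1) := by
  have hp := sqrtQ_ne_zero h0
  have hm : sqrtQ q ^ m ≠ 0 := zpow_ne_zero _ hp
  have hk : sqrtQ q ^ k ≠ 0 := zpow_ne_zero _ hp
  have hp2 : sqrtQ q ^ 2 - 1 ≠ 0 := sub_ne_zero.2 (sqrtQ_pow_ne_one h1 two_ne_zero)
  simp only [dSeq, gammaN, alphaN, zpow_neg, zpow_add₀ hp, zpow_one]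
  field_simp
  ring

/-- Allows every α_n to be eliminated in favour of γ. -/
theorem alphaN_eq {q : ℝ} (h0 : 0 < q) (h1 : q < 1) (n : ℤ) :
    alphaN q n = gammaN q (n + 1) - alpha q * gammaN q n := by
  have hp := sqrtQ_ne_zero h0
  have hw : sqrtQ q ^ n ≠ 0 := zpow_ne_zero _ hp
  have hp2 : sqrtQ q ^ 2 - 1 ≠ 0 := sub_ne_zero.2 (sqrtQ_pow_ne_one h1 two_ne_zero)
  simp only [gammaN, alphaN, alpha, zpow_neg, zpow_add₀ hp, zpow_one]
  field_simp
  ring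

/-- The difference of consecutive `φ^{[n]}` at the points `e_n / d_{2n}`. -/
theorem phiN_sub_phiN {q : ℝ} (h0 : 0 < q) (h1 : q < 1) (a b B₀ C₁ x y : ℂ) (n : ℤ)
    (hx : dSeq q a (2 * n + 2) * x = eSeq q a b B₀ (n + 1))
    (hy : dSeq q a (2 * n) * y = eSeq q a b B₀ n) :
    phiN q a b B₀ C₁ (n + 1) x - phiN q a b B₀ C₁ n y =
      -dSeq q a (2 * n + 1) *
        ((gammaN q (n + 1) * x - gammaN q n * y) ^ 2
          - 2 * alpha q * (gammaN q (n + 1) * x - gammaN q n * y)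
              * (gammaN q (n + 2) * x - gammaN q (n + 1) * y)
          + (gammaN q (n + 2) * x - gammaN q (n + 1) * y) ^ 2 + (alpha q ^ 2 - 1)) := by
  have hI := gammaN_sq_sub h0 h1 n
  -- By the conserved quantity, (x, y) ↦ (γ_{n+1} x - γ_n y, γ_{n+2} x - γ_{n+1} y) preserves the
  -- quadratic form u² - 2αuv + v².
  have hquad : (gammaN q (n + 1) * x - gammaN q n * y) ^ 2
          - 2 * alpha q * (gammaN q (n + 1) * x - gammaN q n * y)
              * (gammaN q (n + 2) * x - gammaN q (n + 1) * y)
          + (gammaN q (n + 2) * x - gammaN q (n + 1) * y) ^ 2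
        = x ^ 2 - 2 * alpha q * x * y + y ^ 2 := by
    rw [gammaN_add_two h0 n]
    linear_combination (x ^ 2 - 2 * alpha q * x * y + y ^ 2) * hI
  rw [hquad]
  have g2 := gammaN_add_two h0 (2 * n)
  have g3 := gammaN_add_two h0 (2 * n + 1)
  have g1 := gammaN_add_two h0 n
  rw [show 2 * n + 1 + 2 = 2 * n + 3 by ring, show 2 * n + 1 + 1 = 2 * n + 2 by ring] at g3
  simp only [dSeq, eSeq, phiN, alphaN_eq h0 h1, show 2 * (n + 1) = 2 * n + 2 by ring,
    show 2 * n + 2 + 1 = 2 * n + 3 by ring, show 2 * n + 1 + 1 = 2 * n + 2 by ring,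
    show n + 1 + 1 = n + 2 by ring] at *
  simp only [g3, g2, g1] at *
  linear_combination (alpha q * x - y) * hx + (alpha q * y - x) * hy

end Constants

/-! ### Algebra of the Askey-Wilson operator -/

section Operator

variable {q : ℝ}

theorem askeyWilson_eq (h0 : 0 < q) (h1 : q < 1) {f g : ℂ[X]} (h : IsAskeyWilsonImage q f g) :
    askeyWilson q f = g :=
  (existsUnique_askeyWilsonImage h0 h1 f).unique (askeyWilson_spec h0 h1 f) h

theorem askeyWilson_add (h0 : 0 < q) (h1 : q < 1) (f g : ℂ[X]) :
    askeyWilson q (f + g) = askeyWilson q f + askeyWilson q g := by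
  refine askeyWilson_eq h0 h1 fun z hz hz2 => ?_
  have hf := askeyWilson_spec h0 h1 f z hz hz2
  have hg := askeyWilson_spec h0 h1 g z hz hz2
  simp only [breve, eval_add] at *
  rw [hf, hg]
  ring

theorem askeyWilson_C_mul (h0 : 0 < q) (h1 : q < 1) (c : ℂ) (f : ℂ[X]) :
    askeyWilson q (C c * f) = C c * askeyWilson q f := by
  refine askeyWilson_eq h0 h1 fun z hz hz2 => ?_
  have hf := askeyWilson_spec h0 h1 f z hz hz2
  simp only [breve, eval_mul, eval_C] at *
  rw [hf]
  ring

theorem askeyWilson_one (h0 : 0 < q) (h1 : q < 1) : askeyWilson q 1 = 0 :=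
  askeyWilson_eq h0 h1 fun z _ _ => by simp [breve]

theorem askeyWilson_X (h0 : 0 < q) (h1 : q < 1) : askeyWilson q X = 1 :=
  askeyWilson_eq h0 h1 fun z hz hz2 => by
    rw [div_self (breve_X_sub_ne_zero h0 h1 hz hz2)]
    simp [breve]

/-- The commutation relation between `D_q` and the multiplication by `x`. -/
theorem askeyWilson_X_mul_X_mul (h0 : 0 < q) (h1 : q < 1) (f : ℂ[X]) :
    askeyWilson q (X * (X * f)) = C (2 * alpha q) * X * askeyWilson q (X * f)
      - X * (X * askeyWilson q f) - C (alpha q ^ 2 - 1) * askeyWilson q f := by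
  refine askeyWilson_eq h0 h1 fun z hz hz2 => ?_
  have hp := sqrtQ_ne_zero h0
  have hne := breve_X_sub_ne_zero h0 h1 hz hz2
  have hf := askeyWilson_spec h0 h1 f z hz hz2
  have hg := askeyWilson_spec h0 h1 (X * f) z hz hz2
  rw [eq_div_iff hne] at *
  simp only [breve, eval_mul, eval_C, eval_sub, eval_X, alpha] at *
  generalize eval ((sqrtQ q * z + (sqrtQ q * z)⁻¹) / 2) f = F at *
  generalize eval (((sqrtQ q)⁻¹ * z + ((sqrtQ q)⁻¹ * z)⁻¹) / 2) f = G at *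
  generalize eval ((z + z⁻¹) / 2) (askeyWilson q f) = u at *
  generalize eval ((z + z⁻¹) / 2) (askeyWilson q (X * f)) = v at *
  generalize sqrtQ q = p at *
  simp only [mul_inv, inv_inv] at *
  have hp' : p * p⁻¹ = 1 := mul_inv_cancel₀ hp
  have hz' : z * z⁻¹ = 1 := mul_inv_cancel₀ hz
  generalize p⁻¹ = r at *
  generalize z⁻¹ = w at *
  -- With x = (z + 1/z)/2, the two sample points have sum 2αx and product x² + α² - 1. Hence both
  -- are roots t of t² = 2αx t - (x² + α² - 1); multiply by f(t) and subtract.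
  linear_combination (p + r) * (z + w) / 2 * hg
    - (((z + w) / 2) ^ 2 + ((p + r) / 2) ^ 2 - 1) * hf
    + (F - G) * ((z ^ 2 + w ^ 2) / 4 - 1 / 2) * hp' + (F - G) * ((p ^ 2 + r ^ 2) / 4 - 1 / 2) * hz'

end Operator

/-! ### Favard's theorem -/

section Favard

theorem degree_eq_of_recurrence {Q : ℕ → ℂ[X]} {A B D : ℕ → ℂ} (hQ0 : Q 0 = 1)
    (hA : ∀ n, A n ≠ 0) (hz : X * Q 0 = C (A 0) * Q 1 + C (B 0) * Q 0)
    (hs : ∀ n, X * Q (n + 1) =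
      C (A (n + 1)) * Q (n + 2) + C (B (n + 1)) * Q (n + 1) + C (D n) * Q n) (n : ℕ) :
    (Q n).degree = n ∧ (Q (n + 1)).degree = (n + 1 : ℕ) := by
  induction n with
  | zero =>
    refine ⟨by simp [hQ0], ?_⟩
    have h : C (A 0) * Q 1 = X - C (B 0) := by
      rw [hQ0] at hz
      linear_combination -hz
    have h2 := congrArg degree h
    rw [degree_C_mul (hA 0), degree_X_sub_C] at h2
    simpa using h2
  | succ n ih =>
    refine ⟨ih.2, ?_⟩
    have h : C (A (n + 1)) * Q (n + 2) =
        X * Q (n + 1) - (B (n + 1) • Q (n + 1) + D n • Q n) := by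
      rw [smul_eq_C_mul, smul_eq_C_mul]
      linear_combination -hs n
    have h2 := congrArg degree h
    have hX : (X * Q (n + 1)).degree = ((n + 2 : ℕ) : WithBot ℕ) := by
      rw [degree_mul, degree_X, ih.2, add_comm]
      rfl
    have hlt : (B (n + 1) • Q (n + 1) + D n • Q n).degree < (X * Q (n + 1)).degree := by
      rw [hX]
      refine (degree_add_le _ _).trans_lt (max_lt ?_ ?_)
      · refine (degree_smul_le _ _).trans_lt ?_
        rw [ih.2]
        exact_mod_cast Nat.lt_succ_self _
      · refine (degree_smul_le _ _).trans_lt ?_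
        rw [ih.1]
        exact_mod_cast (by omega : n < n + 2)
    rwa [degree_C_mul (hA _), degree_sub_eq_left_of_degree_lt hlt, hX] at h2

/-- The coordinate functional dual to the first element of a polynomial sequence. -/
theorem exists_functional_of_degree_eq {Q : ℕ → ℂ[X]} (hdeg : ∀ n, (Q n).degree = n) :
    ∃ v : ℂ[X] →ₗ[ℂ] ℂ, v (Q 0) = 1 ∧ ∀ n, v (Q (n + 1)) = 0 := by
  let S : Polynomial.Sequence ℂ := ⟨Q, hdeg⟩
  have hlead : ∀ i, IsUnit (S i).leadingCoeff := fun i =>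
    (leadingCoeff_ne_zero.2 (S.ne_zero i)).isUnit
  have hSQ : ∀ n, Q n = S.basis hlead n := fun n =>
    (S.basis_eq_self hlead n).symm
  generalize S.basis hlead = e at hSQ
  refine ⟨e.coord 0, ?_, fun n => ?_⟩
  · rw [hSQ]
    simp
  · rw [hSQ]
    simp

/-- A sequence of polynomials satisfying a three term recurrence relation with nonvanishing
coefficients is orthogonal. -/
theorem exists_isOPS_of_recurrence {Q : ℕ → ℂ[X]} {A B D : ℕ → ℂ} (hQ0 : Q 0 = 1)
    (hA : ∀ n, A n ≠ 0) (hD : ∀ n, D n ≠ 0)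
    (hz : X * Q 0 = C (A 0) * Q 1 + C (B 0) * Q 0)
    (hs : ∀ n, X * Q (n + 1) =
      C (A (n + 1)) * Q (n + 2) + C (B (n + 1)) * Q (n + 1) + C (D n) * Q n) :
    ∃ v : ℂ[X] →ₗ[ℂ] ℂ, IsOPS v Q := by
  have hdeg : ∀ n, (Q n).degree = n := fun n => (degree_eq_of_recurrence hQ0 hA hz hs n).1
  obtain ⟨v, hv0, hvs⟩ := exists_functional_of_degree_eq hdeg
  have hQne : ∀ n, Q n ≠ 0 := fun n h => by
    have := hdeg n
    rw [h, degree_zero] at this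
    exact WithBot.bot_ne_coe this
  have hvC : ∀ c f, v (C c * f) = c * v f := fun c f => by
    rw [← smul_eq_C_mul, map_smul, smul_eq_mul]
  have hmul : ∀ k n, X ^ (k + 1) * Q (n + 1) = C (A (n + 1)) * (X ^ k * Q (n + 2))
      + C (B (n + 1)) * (X ^ k * Q (n + 1)) + C (D n) * (X ^ k * Q n) := fun k n => by
    linear_combination X ^ k * hs n
  -- Each factor X lowers the index by at most one, so fewer than n factors never reach Q 0.
  have hzero : ∀ k n, k < n → v (X ^ k * Q n) = 0 := by
    intro k
    induction k with
    | zero =>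
      intro n hn
      obtain ⟨m, rfl⟩ := Nat.exists_eq_succ_of_ne_zero hn.ne'
      simpa using hvs m
    | succ k ih =>
      intro n hn
      obtain ⟨m, rfl⟩ := Nat.exists_eq_succ_of_ne_zero (by omega : n ≠ 0)
      rw [hmul, map_add, map_add, hvC, hvC, hvC, ih _ (by omega), ih _ (by omega),
        ih _ (by omega)]
      simp
  -- Only the D term survives, so the value is D 0 ⋯ D (n - 1).
  have hne : ∀ n, v (X ^ n * Q n) ≠ 0 := by
    intro n
    induction n with
    | zero => simp [hv0]
    | succ n ih =>
      rw [hmul, map_add, map_add, hvC, hvC, hvC, hzero _ _ (by omega), hzero _ _ (by omega)]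
      simpa using ⟨hD n, ih⟩
  have hlow : ∀ (n : ℕ) (f : ℂ[X]), f.degree < (n : WithBot ℕ) → v (f * Q n) = 0 := by
    intro n f hf
    rw [f.as_sum_support_C_mul_X_pow, Finset.sum_mul, map_sum]
    refine Finset.sum_eq_zero fun i hi => ?_
    have hin : i < n := by exact_mod_cast (le_degree_of_mem_supp i hi).trans_lt hf
    rw [mul_assoc, hvC, hzero _ _ hin, mul_zero]
  have hlt : ∀ m n, m < n → v (Q m * Q n) = 0 := fun m n h =>
    hlow n _ (by rw [hdeg]; exact_mod_cast h)
  refine ⟨v, hdeg, fun n m hnm => ?_, fun n => ?_⟩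
  · rcases lt_or_gt_of_ne hnm with h | h
    · exact hlt _ _ h
    · rw [mul_comm]
      exact hlt _ _ h
  -- Modulo lower degree, which `hlow` kills, one factor Q n is its leading term.
  · have h : (Q n - C (Q n).leadingCoeff * X ^ n).degree < (n : WithBot ℕ) := by
      have h3 := degree_sub_lt_left (p := Q n) (q := C (Q n).leadingCoeff * X ^ n) ?_ ?_ ?_
      · rwa [hdeg] at h3
      · rw [degree_C_mul_X_pow _ (leadingCoeff_ne_zero.2 (hQne n)), hdeg]
      · exact hQne n
      · simp
    have h2 := hlow n _ h
    rw [sub_mul, map_sub, mul_assoc, hvC, sub_eq_zero] at h2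
    rw [h2]
    exact mul_ne_zero (leadingCoeff_ne_zero.2 (hQne n)) (hne n)

end Favard

/-! ### Coefficients of the derived recurrence and their five identities -/

noncomputable section

section Coefficients

variable {q : ℝ} {a b B₀ C₁ : ℂ}

/-- The points `e_n / d_{2n}`. -/
def node (q : ℝ) (a b B₀ : ℂ) (n : ℤ) : ℂ := eSeq q a b B₀ n / dSeq q a (2 * n)

/-- The leading coefficient in the recurrence relation of `(D_q P_{n+1})_n`. -/
def derA (q : ℝ) (n : ℕ) : ℂ := gammaN q (n + 1) / gammaN q (n + 2)

/-- The middle coefficient in the recurrence relation of `(D_q P_{n+1})_n`. -/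
def derB (q : ℝ) (a b B₀ : ℂ) (n : ℕ) : ℂ :=
  gammaN q (n + 1) * node q a b B₀ (n + 1) - gammaN q n * node q a b B₀ n

/-- The last coefficient in the recurrence relation of `(D_q P_{n+1})_n`. -/
def derC (q : ℝ) (a b B₀ C₁ : ℂ) (n : ℕ) : ℂ :=
  dSeq q a n / dSeq q a (n - 1) * recC q a b B₀ C₁ n

theorem gammaN_add_one_ne_zero (h0 : 0 < q) (h1 : q < 1) (n : ℕ) :
    gammaN q ((n : ℤ) + 1) ≠ 0 := by
  exact_mod_cast gammaN_natCast_ne_zero h0 h1 n.succ_ne_zero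

theorem gammaN_add_two_ne_zero (h0 : 0 < q) (h1 : q < 1) (n : ℕ) :
    gammaN q ((n : ℤ) + 2) ≠ 0 := by
  exact_mod_cast gammaN_natCast_ne_zero h0 h1 (n + 1).succ_ne_zero

theorem derA_ne_zero (h0 : 0 < q) (h1 : q < 1) (n : ℕ) : derA q n ≠ 0 :=
  div_ne_zero (gammaN_add_one_ne_zero h0 h1 n) (gammaN_add_two_ne_zero h0 h1 n)

theorem recB_succ (n : ℕ) : recB q a b B₀ (n + 1) =
    gammaN q (n + 2) * node q a b B₀ (n + 1) - gammaN q (n + 1) * node q a b B₀ n := by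
  simp only [recB, node]
  push_cast
  rw [show (n : ℤ) + 1 + 1 = n + 2 by ring, show (n : ℤ) + 1 - 1 = n by ring,
    show 2 * ((n : ℤ) + 1) - 2 = 2 * n by ring]
  ring

theorem recB_zero (h0 : 0 < q) (h1 : q < 1) : recB q a b B₀ 0 = node q a b B₀ 0 := by
  simp [recB, node, gammaN_one h0 h1]

theorem dSeq_ne_zero (hd : ∀ n : ℕ, dSeq q a n ≠ 0) {n : ℤ} (hn : 0 ≤ n) : dSeq q a n ≠ 0 := by
  lift n to ℕ using hn
  exact hd n

theorem dSeq_mul_node (hd : ∀ n : ℕ, dSeq q a n ≠ 0) {n : ℤ} (hn : 0 ≤ n) :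
    dSeq q a (2 * n) * node q a b B₀ n = eSeq q a b B₀ n :=
  mul_div_cancel₀ _ (dSeq_ne_zero hd (by omega))

theorem recC_succ (n : ℕ) : recC q a b B₀ C₁ (n + 1) =
    -(gammaN q (n + 2) / dSeq q a (2 * n + 3) * (dSeq q a n / dSeq q a (2 * n + 1))) *
      phiN q a b B₀ C₁ (n + 1) (node q a b B₀ (n + 1)) := by
  simp only [recC, node, dRatio, if_neg n.succ_ne_zero]
  push_cast
  rw [show (n : ℤ) + 1 + 1 = n + 2 by ring, show (n : ℤ) + 1 - 1 = n by ring,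
    show 2 * ((n : ℤ) + 1) + 1 = 2 * n + 3 by ring,
    show 2 * ((n : ℤ) + 1) - 1 = 2 * n + 1 by ring]

theorem recC_zero (h0 : 0 < q) (h1 : q < 1) : recC q a b B₀ C₁ 0 =
    -phiN q a b B₀ C₁ 0 (node q a b B₀ 0) / dSeq q a 1 := by
  simp only [recC, node, dRatio, Nat.cast_zero, mul_zero, zero_add, gammaN_one h0 h1, if_true]
  ring

theorem derC_succ_ne_zero (hd : ∀ n : ℕ, dSeq q a n ≠ 0)
    (hC : ∀ n : ℕ, recC q a b B₀ C₁ n ≠ 0) (n : ℕ) : derC q a b B₀ C₁ (n + 1) ≠ 0 :=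
  mul_ne_zero (div_ne_zero (hd _) (dSeq_ne_zero hd (by push_cast; omega))) (hC _)

/-- The recurrence of γ gives 2α - A_n = γ_{n+3}/γ_{n+2}. This is hypothesis `i₄` of
`recurrence_step`. -/
theorem derA_succ_mul (h0 : 0 < q) (h1 : q < 1) (n : ℕ) :
    derA q (n + 1) * (2 * alpha q - derA q n) = 1 := by
  have g1 := gammaN_add_one_ne_zero h0 h1 n
  have g2 := gammaN_add_two_ne_zero h0 h1 n
  have g3 := gammaN_add_two_ne_zero h0 h1 (n + 1)
  have h := gammaN_add_two h0 ((n : ℤ) + 1)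
  simp only [derA]
  push_cast at *
  rw [show (n : ℤ) + 1 + 1 = n + 2 by ring, show (n : ℤ) + 1 + 2 = n + 3 by ring] at *
  field_simp
  linear_combination -h

/-- Hypothesis `i₃`. It holds whatever the nodes are: their coefficients agree by the recurrence of
γ. -/
theorem derB_succ_mul (h0 : 0 < q) (h1 : q < 1) (n : ℕ) :
    derB q a b B₀ (n + 1) * (2 * alpha q - derA q n) =
      derA q n * (derB q a b B₀ n - 2 * alpha q * recB q a b B₀ (n + 1))
        + recB q a b B₀ (n + 1) + recB q a b B₀ (n + 2) := by
  have g2 := gammaN_add_two_ne_zero h0 h1 n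
  have h := gammaN_add_two h0 ((n : ℤ) + 1)
  have h' := gammaN_add_two h0 (n : ℤ)
  simp only [derA, derB, recB_succ]
  push_cast at *
  rw [show (n : ℤ) + 1 + 1 = n + 2 by ring, show (n : ℤ) + 1 + 2 = n + 3 by ring] at *
  rw [h]
  generalize node q a b B₀ (n + 2) = z
  generalize node q a b B₀ (n + 1) = x
  generalize node q a b B₀ n = y
  field_simp
  rw [h']
  ring

/-- The addition formula d_{n+1} γ_{n+3} - d_n γ_{n+2} = d_{2n+3} cancels one denominator of
C_{n+2}. -/
theorem recC_succ_sub_derC_succ (h0 : 0 < q) (h1 : q < 1) (hd : ∀ n : ℕ, dSeq q a n ≠ 0) (n : ℕ) :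
    recC q a b B₀ C₁ (n + 1) - derC q a b B₀ C₁ (n + 1) * (2 * alpha q - derA q n) =
      phiN q a b B₀ C₁ (n + 1) (node q a b B₀ (n + 1)) / dSeq q a (2 * n + 1) := by
  have g2 := gammaN_add_two_ne_zero h0 h1 n
  have h := gammaN_add_two h0 ((n : ℤ) + 1)
  have hm := dSeq_mul_gammaN_sub h0 h1 a n (n + 2)
  have d0 := hd n
  have d1 : dSeq q a (2 * n + 1) ≠ 0 := dSeq_ne_zero hd (by omega)
  have d3 : dSeq q a (2 * n + 3) ≠ 0 := dSeq_ne_zero hd (by omega)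
  simp only [derA, derC, recC_succ]
  push_cast at *
  rw [show (n : ℤ) + 1 + 1 = n + 2 by ring, show (n : ℤ) + 1 + 2 = n + 3 by ring] at h
  rw [show (n : ℤ) + (n + 2) + 1 = 2 * n + 3 by ring, show (n : ℤ) + 2 + 1 = n + 3 by ring, h] at hm
  rw [show (n : ℤ) + 1 - 1 = n by ring]
  generalize phiN q a b B₀ C₁ (n + 1) (node q a b B₀ (n + 1)) = F
  field_simp
  linear_combination F * hm

theorem recC_add_derC (h0 : 0 < q) (h1 : q < 1) (hd : ∀ n : ℕ, dSeq q a n ≠ 0) (n : ℕ) :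
    recC q a b B₀ C₁ n + (derC q a b B₀ C₁ n - 2 * alpha q * recC q a b B₀ C₁ n) *
        (gammaN q n / gammaN q (n + 1)) =
      -phiN q a b B₀ C₁ n (node q a b B₀ n) / dSeq q a (2 * n + 1) := by
  cases n with
  -- The factor γ_0 = 0 removes `derC` at 0, whose denominator d_{-1} may vanish.
  | zero => simp [recC_zero h0 h1]
  | succ n =>
    have g1 := gammaN_add_one_ne_zero h0 h1 n
    have g2 := gammaN_add_two_ne_zero h0 h1 n
    have h := dSeq_add_two h0 a ((n : ℤ) - 1)
    have hm := dSeq_mul_gammaN_sub h0 h1 a (n - 1) (n + 1)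
    have d0 := hd n
    have d1 : dSeq q a (2 * n + 1) ≠ 0 := dSeq_ne_zero hd (by omega)
    have d3 : dSeq q a (2 * n + 3) ≠ 0 := dSeq_ne_zero hd (by omega)
    simp only [derC, recC_succ]
    push_cast at *
    rw [show (n : ℤ) - 1 + 2 = n + 1 by ring, show (n : ℤ) - 1 + 1 = n by ring] at h
    rw [show (n : ℤ) - 1 + 1 = n by ring, show (n : ℤ) - 1 + (n + 1) + 1 = 2 * n + 1 by ring,
      show (n : ℤ) + 1 + 1 = n + 2 by ring] at hm
    rw [show (n : ℤ) + 1 - 1 = n by ring, show (n : ℤ) + 1 + 1 = n + 2 by ring,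
      show 2 * ((n : ℤ) + 1) + 1 = 2 * n + 3 by ring]
    generalize phiN q a b B₀ C₁ (n + 1) (node q a b B₀ (n + 1)) = F
    rw [h]
    field_simp
    linear_combination -F * hm

/-- Hypothesis `i₂`. The two preceding lemmas turn the C terms into φ^{[n+1]} and φ^{[n]} at their
nodes, both over d_{2n+1}; `phiN_sub_phiN` supplies their difference. -/
theorem derC_succ_mul (h0 : 0 < q) (h1 : q < 1) (hd : ∀ n : ℕ, dSeq q a n ≠ 0) (n : ℕ) :
    derC q a b B₀ C₁ (n + 1) * (2 * alpha q - derA q n) =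
      derB q a b B₀ n ^ 2 - 2 * alpha q * recB q a b B₀ (n + 1) * derB q a b B₀ n
        + (derC q a b B₀ C₁ n - 2 * alpha q * recC q a b B₀ C₁ n) *
          (gammaN q n / gammaN q (n + 1))
        + recC q a b B₀ C₁ (n + 1) + recB q a b B₀ (n + 1) ^ 2 + recC q a b B₀ C₁ n
        + (alpha q ^ 2 - 1) := by
  have t1 := recC_succ_sub_derC_succ (b := b) (B₀ := B₀) (C₁ := C₁) h0 h1 hd n
  have t2 := recC_add_derC (b := b) (B₀ := B₀) (C₁ := C₁) h0 h1 hd n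
  have d1 : dSeq q a (2 * n + 1) ≠ 0 := dSeq_ne_zero hd (by omega)
  have hx := dSeq_mul_node (b := b) (B₀ := B₀) hd (n := (n : ℤ) + 1) (by omega)
  have hy := dSeq_mul_node (b := b) (B₀ := B₀) hd (n := (n : ℤ)) (by omega)
  rw [show 2 * ((n : ℤ) + 1) = 2 * n + 2 by ring] at hx
  have h := phiN_sub_phiN h0 h1 a b B₀ C₁ _ _ n hx hy
  rw [recB_succ, derB]
  have h' := congrArg (· / dSeq q a (2 * n + 1)) h
  simp only [sub_div, neg_mul, neg_div, mul_div_cancel_left₀ _ d1] at h'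
  linear_combination -t1 - t2 - h'

/-- Hypothesis `i₁`. After the common factor C_{n+2}/d_n is removed, the addition formula leaves, up
to sign, d_{2n+4} x_{n+2} - 2α d_{2n+2} x_{n+1} + d_{2n} x_n, which is e_{n+2} - 2α e_{n+1} + e_n =
0. -/
theorem derC_mul_derB (h0 : 0 < q) (h1 : q < 1) (hd : ∀ n : ℕ, dSeq q a n ≠ 0) (n : ℕ) :
    derC q a b B₀ C₁ (n + 1) *
        (derB q a b B₀ (n + 1) + derB q a b B₀ n - 2 * alpha q * recB q a b B₀ (n + 2))
      + recC q a b B₀ C₁ (n + 1) *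
        (recB q a b B₀ (n + 2) + recB q a b B₀ (n + 1) - 2 * alpha q * derB q a b B₀ n) = 0 := by
  have hx := dSeq_mul_node (b := b) (B₀ := B₀) hd (n := (n : ℤ) + 2) (by omega)
  have hy := dSeq_mul_node (b := b) (B₀ := B₀) hd (n := (n : ℤ) + 1) (by omega)
  have hz := dSeq_mul_node (b := b) (B₀ := B₀) hd (n := (n : ℤ)) (by omega)
  have m1 := dSeq_mul_gammaN_sub h0 h1 a n (n + 3)
  have m2 := dSeq_mul_gammaN_sub h0 h1 a n (n + 1)
  have m3 := dSeq_mul_gammaN_sub h0 h1 a n (n - 1)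
  have he := eSeq_add_two h0 a b B₀ n
  have d0 := hd n
  have k1 := gammaN_add_two h0 ((n : ℤ) - 1)
  have k4 := gammaN_add_two h0 ((n : ℤ) + 2)
  simp only [derC, derB, recB_succ]
  push_cast at *
  rw [show (n : ℤ) + 3 + 1 = n + 4 by ring, show (n : ℤ) + (n + 3) + 1 = 2 * (n + 2) by ring] at m1
  rw [show (n : ℤ) + 1 + 1 = n + 2 by ring, show (n : ℤ) + (n + 1) + 1 = 2 * (n + 1) by ring] at m2
  rw [show (n : ℤ) - 1 + 1 = n by ring, show (n : ℤ) + (n - 1) + 1 = 2 * n by ring] at m3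
  rw [show (n : ℤ) - 1 + 2 = n + 1 by ring, show (n : ℤ) - 1 + 1 = n by ring] at k1
  rw [show (n : ℤ) + 2 + 2 = n + 4 by ring, show (n : ℤ) + 2 + 1 = n + 3 by ring] at k4
  rw [show (n : ℤ) + 1 + 1 = n + 2 by ring, show (n : ℤ) + 1 + 2 = n + 3 by ring,
    show (n : ℤ) + 1 - 1 = n by ring]
  generalize node q a b B₀ (n + 2) = z at *
  generalize node q a b B₀ (n + 1) = x at *
  generalize node q a b B₀ n = y at *
  generalize recC q a b B₀ C₁ (n + 1) = c at *
  field_simp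
  linear_combination c * (-z * m1 + 2 * alpha q * x * m2 - y * m3 - hx + 2 * alpha q * hy - hz - he
    + z * dSeq q a (n + 1) * k4 - y * dSeq q a n * k1)

/-- Hypothesis `i₀`: the recurrence of d, divided by d_n and multiplied by C_{n+3} C_{n+2}. -/
theorem derC_mul_derC (h0 : 0 < q) (hd : ∀ n : ℕ, dSeq q a n ≠ 0) (n : ℕ) :
    derC q a b B₀ C₁ (n + 2) * derC q a b B₀ C₁ (n + 1)
      - 2 * alpha q * recC q a b B₀ C₁ (n + 2) * derC q a b B₀ C₁ (n + 1)
      + recC q a b B₀ C₁ (n + 2) * recC q a b B₀ C₁ (n + 1) = 0 := by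
  have h := dSeq_add_two h0 a n
  have d0 := hd n
  have d1 : dSeq q a (n + 1) ≠ 0 := dSeq_ne_zero hd (by omega)
  simp only [derC]
  push_cast
  rw [show (n : ℤ) + 2 - 1 = n + 1 by ring, show (n : ℤ) + 1 - 1 = n by ring, h]
  field_simp
  ring

end Coefficients

end

/-! ### The recurrence for the images under D_q -/

section Main

variable {q : ℝ}

/-- The relation between five consecutive images under `D_q` of a sequence satisfying a three term
recurrence relation. -/
theorem askeyWilson_five_term (h0 : 0 < q) (h1 : q < 1) {p₀ p₁ p₂ p₃ p₄ : ℂ[X]}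
    {b₁ b₂ b₃ c₁ c₂ c₃ : ℂ} (e₁ : X * p₁ = p₂ + C b₁ * p₁ + C c₁ * p₀)
    (e₂ : X * p₂ = p₃ + C b₂ * p₂ + C c₂ * p₁) (e₃ : X * p₃ = p₄ + C b₃ * p₃ + C c₃ * p₂) :
    askeyWilson q p₄ + C (b₃ + b₂) * askeyWilson q p₃
        + C (c₃ + b₂ ^ 2 + c₂) * askeyWilson q p₂ + C (c₂ * (b₂ + b₁)) * askeyWilson q p₁
        + C (c₂ * c₁) * askeyWilson q p₀ =
      C (2 * alpha q) * X *
          (askeyWilson q p₃ + C b₂ * askeyWilson q p₂ + C c₂ * askeyWilson q p₁)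
        - X * (X * askeyWilson q p₂) - C (alpha q ^ 2 - 1) * askeyWilson q p₂ := by
  have h := askeyWilson_X_mul_X_mul h0 h1 p₂
  have hXX : X * (X * p₂) = p₄ + C (b₃ + b₂) * p₃ + C (c₃ + b₂ ^ 2 + c₂) * p₂
      + C (c₂ * (b₂ + b₁)) * p₁ + C (c₂ * c₁) * p₀ := by
    simp only [C_add, C_mul, C_pow]
    linear_combination X * e₂ + e₃ + C b₂ * e₂ + C c₂ * e₁
  rw [hXX, e₂] at h
  simpa only [askeyWilson_add h0 h1, askeyWilson_C_mul h0 h1] using h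

/-- The induction step for the recurrence relation satisfied by the images under `D_q`. -/
theorem recurrence_step {g₀ g₁ g₂ g₃ g₄ : ℂ[X]}
    {t k b₁ b₂ b₃ c₁ c₂ c₃ A₁ A₂ A₃ B₁ B₂ B₃ D₁ D₂ D₃ : ℂ}
    (hF : g₄ + C (b₃ + b₂) * g₃ + C (c₃ + b₂ ^ 2 + c₂) * g₂ + C (c₂ * (b₂ + b₁)) * g₁
        + C (c₂ * c₁) * g₀ =
      C t * X * (g₃ + C b₂ * g₂ + C c₂ * g₁) - X * (X * g₂) - C k * g₂)
    (h₁ : X * g₁ = C A₁ * g₂ + C B₁ * g₁ + C D₁ * g₀)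
    (h₂ : X * g₂ = C A₂ * g₃ + C B₂ * g₂ + C D₂ * g₁)
    (i₄ : A₃ * (t - A₂) = 1)
    (i₃ : B₃ * (t - A₂) = A₂ * (B₂ - t * b₂) + b₂ + b₃)
    (i₂ : D₃ * (t - A₂) =
      B₂ ^ 2 - t * b₂ * B₂ + (D₂ - t * c₂) * A₁ + c₃ + b₂ ^ 2 + c₂ + k)
    (i₁ : C (D₂ * (B₂ + B₁ - t * b₂) + c₂ * (b₂ + b₁ - t * B₁)) * g₁ = 0)
    (i₀ : C (D₂ * D₁ - t * c₂ * D₁ + c₂ * c₁) * g₀ = 0) :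
    X * g₃ = C A₃ * g₄ + C B₃ * g₃ + C D₃ * g₂ := by
  have j₄ := congrArg C i₄
  have j₃ := congrArg C i₃
  have j₂ := congrArg C i₂
  -- Expanding X (X g₂) by `h₂`, then X g₁ by `h₁`, isolates (t - A₂) X g₃; by `i₄`, A₃ inverts t -
  -- A₂.
  have key : C (t - A₂) * (X * g₃) = g₄ + C (t - A₂) * (C B₃ * g₃ + C D₃ * g₂) := by
    simp only [C_add, C_mul, C_sub, C_pow] at *
    linear_combination -hF + (X + C B₂ - C t * C b₂) * h₂ + (C D₂ - C t * C c₂) * h₁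
      - g₃ * j₃ - g₂ * j₂ + i₁ + i₀
  simp only [C_mul, C_sub, C_1] at *
  linear_combination C A₃ * key - (X * g₃ - C B₃ * g₃ - C D₃ * g₂) * j₄

variable {a b B₀ C₁ : ℂ} {P : ℕ → ℂ[X]}

/-- The recurrence relation satisfied by `(D_q P_{n+1})_n`. -/
theorem askeyWilson_recurrence (h0 : 0 < q) (h1 : q < 1) (hd : ∀ n : ℕ, dSeq q a n ≠ 0)
    (hP0 : P 0 = 1) (hrec : HasTTRR P (recB q a b B₀) (recC q a b B₀ C₁)) (n : ℕ) :
    X * askeyWilson q (P (n + 1)) = C (derA q n) * askeyWilson q (P (n + 2))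
      + C (derB q a b B₀ n) * askeyWilson q (P (n + 1))
      + C (derC q a b B₀ C₁ n) * askeyWilson q (P n) := by
  obtain ⟨r0, r⟩ := hrec
  have hD0 : askeyWilson q (P 0) = 0 := by rw [hP0, askeyWilson_one h0 h1]
  have hz : askeyWilson q 0 = 0 := by
    simpa using askeyWilson_C_mul h0 h1 0 0
  have r0' : X * P 0 = P 1 + C (recB q a b B₀ 0) * P 0 + C 0 * 0 := by
    rw [r0]
    simp
  induction n using Nat.strong_induction_on with
  | _ n ih =>
    match n with
    | 0 =>
      -- A formal recurrence at P_{-1} = 0: its spurious last term enters the five-term relation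
      -- only through c₂ c₁, and c₂ = 0 in `r0'`.
      have e : X * (0 : ℂ[X]) = P 0 + C 0 * 0 + C (-1) * P 0 := by simp
      have hF := askeyWilson_five_term h0 h1 e r0' (r 0)
      have hg := gammaN_add_two_ne_zero h0 h1 0
      have hA := gammaN_add_two h0 0
      simp only [Nat.cast_zero, zero_add, gammaN_zero, gammaN_one h0 h1, mul_one, sub_zero]
        at hA hg
      have i₄ : derA q 0 * (2 * alpha q) = 1 := by
        simp only [derA, Nat.cast_zero, zero_add, gammaN_one h0 h1, ← hA]
        field_simp
      have i₃ : derB q a b B₀ 0 * (2 * alpha q) = recB q a b B₀ 1 + recB q a b B₀ 0 := by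
        have h := recB_succ (q := q) (a := a) (b := b) (B₀ := B₀) 0
        simp only [derB, Nat.cast_zero, zero_add, gammaN_one h0 h1, gammaN_zero] at h ⊢
        rw [h, recB_zero h0 h1, hA]
        ring
      simp only [hD0, hz, mul_zero, add_zero, sub_zero, zero_add] at hF ⊢
      have j₄ := congrArg C i₄
      have j₃ := congrArg C i₃
      simp only [C_mul, C_add, C_1] at hF j₄ j₃
      linear_combination -C (derA q 0) * hF + C (derA q 0) * askeyWilson q (P 1) * (-j₃)
        + (C (derB q a b B₀ 0) - X) * askeyWilson q (P 1) * j₄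
    | 1 =>
      have hF := askeyWilson_five_term h0 h1 r0' (r 0) (r 1)
      have h2 := ih 0 one_pos
      have hC := derC_succ_mul (b := b) (B₀ := B₀) (C₁ := C₁) h0 h1 hd 0
      -- Here g₀ = g₁ = 0, so `h₁`, `i₁` and `i₀` are trivial; A₁ = 0 matches γ_0/γ_1 = 0 in `hC`.
      refine recurrence_step (A₁ := 0) (B₁ := 0) (D₁ := 0) hF ?_ h2
        (derA_succ_mul h0 h1 0) (derB_succ_mul h0 h1 0) ?_ ?_ ?_
      · simp [hD0, hz]
      · simp only [Nat.cast_zero, gammaN_zero, zero_div, mul_zero] at hC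
        linear_combination hC
      · simp [hD0]
      · simp [hz]
    | n + 2 =>
      have hF := askeyWilson_five_term h0 h1 (r n) (r (n + 1)) (r (n + 2))
      have h1' := ih n (by omega)
      have h2 := ih (n + 1) (by omega)
      have hC := derC_succ_mul (b := b) (B₀ := B₀) (C₁ := C₁) h0 h1 hd (n + 1)
      refine recurrence_step hF h1' h2 (derA_succ_mul h0 h1 (n + 1))
        (derB_succ_mul h0 h1 (n + 1)) ?_ ?_ ?_
      · have hA : derA q n = gammaN q (n + 1 : ℕ) / gammaN q ((n + 1 : ℕ) + 1) := by
          simp only [derA]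
          push_cast
          rw [show (n : ℤ) + 1 + 1 = n + 2 by ring]
        rw [hA]
        linear_combination hC
      · rw [derC_mul_derB h0 h1 hd n, C_0, zero_mul]
      -- For n = 0 the coefficient involves `derC` at 0, but it multiplies D_q P_0 = 0.
      · cases n with
        | zero => rw [hD0, mul_zero]
        | succ n => rw [derC_mul_derC h0 hd n, C_0, zero_mul]

end Main

end QLattice

theorem theorem2 (q : ℝ) (hq0 : 0 < q) (hq1 : q < 1)
    (B₀ B₁ C₁ C₂ a b : ℂ)
    (ha : a = QLattice.parA q B₀ B₁ C₁ C₂)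
    (hb : b = QLattice.parB q a B₀ B₁)
    -- all the denominators in the formulas are nonzero
    (hC₂ : C₂ ≠ 0)
    (hd : ∀ n : ℕ, QLattice.dSeq q a n ≠ 0)
    -- `C_n ≠ 0` for all `n ≥ 1`
    (hC : ∀ n : ℕ, QLattice.recC q a b B₀ C₁ n ≠ 0)
    -- a monic OPS with these recurrence coefficients
    (u : Polynomial ℂ →ₗ[ℂ] ℂ) (P : ℕ → Polynomial ℂ)
    (hP : QLattice.IsMonicOPS u P)
    (hrec : QLattice.HasTTRR P (QLattice.recB q a b B₀) (QLattice.recC q a b B₀ C₁)) :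
    QLattice.IsClassical q u P := by
  have hP0 : P 0 = 1 :=
    (hP.2 0).natDegree_eq_zero.1 (natDegree_eq_of_degree_eq_some (hP.1.1 0))
  have hrel := QLattice.askeyWilson_recurrence hq0 hq1 hd hP0 hrec
  have hD0 : QLattice.askeyWilson q (P 0) = 0 := by
    rw [hP0, QLattice.askeyWilson_one hq0 hq1]
  have hD1 : QLattice.askeyWilson q (P 1) = 1 := by
    have h := congrArg (QLattice.askeyWilson q) hrec.1
    rwa [QLattice.askeyWilson_add hq0 hq1, QLattice.askeyWilson_C_mul hq0 hq1, hD0, hP0, mul_one,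
      QLattice.askeyWilson_X hq0 hq1, mul_zero, add_zero, eq_comm] at h
  -- The shift in D discards `derC` at 0, which only multiplies D_q P_0 = 0, and leaves the nonzero
  -- coefficients.
  refine ⟨hP, QLattice.exists_isOPS_of_recurrence (A := QLattice.derA q)
    (B := QLattice.derB q a b B₀) (D := fun n => QLattice.derC q a b B₀ C₁ (n + 1)) hD1
    (QLattice.derA_ne_zero hq0 hq1) (QLattice.derC_succ_ne_zero hd hC) ?_ fun n => hrel (n + 1)⟩
  simpa [hD0] using hrel 0
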